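/- Let $n\ge 8$ with $n\equiv 0\pmod 4$, let $m=n/2$, and let the $n$ teams be ordered in any way as $t_1,\dots,t_n$. Put $u_i=\{t_{2i-1},t_{2i}\}$ for $1\le i\le m$ (the super-teams). Write $x\to y$ for a game of $x$ against $y$ at the home venue of $y$ (both for teams and for super-teams). **Construction.** There are $m-1$ time slots $q=1,\dots,m-1$. In slot $1$ the super-team $u_i$ ($1\le i\le m-1$) is at position $i$ of a cycle of $m-1$ positions; from each slot to the next, $u_1,\dots,u_{m-1}$ all move on by one position (from $p$ to $p+1$, and from $m-1$ to $1$), while $u_m$ does not move. In each slot the super-teams at positions $p$ and $m-1-p$ ($1\le p\le m/2-1$) play a super-game, and the super-team at position $m-1$ plays a super-game against $u_m$. Super-games are directed as follows. In slot $1$ the edge between positions $p$ and $m-1-p$ leaves the even one of the two positions, and the edge between position $m-1$ and $u_m$ enters $u_m$. From each slot to the next all edges are reversed (as edges between positions), except that the edge at $u_m$ is not reversed from slot $1$ to slot $2$. Super-games in slot $m-1$ are *last*, those in slot $m-2$ *penultimate*, those in slots $2\le q\le m-3$ that involve $u_m$ *left*, and all others *normal*. A super-game $\{a,b\}\to\{c,d\}$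 in slot $q$, with $(a,b)=(t_{2i-1},t_{2i})$ and $(c,d)=(t_{2j-1},t_{2j})$, is extended to the following games on the days $4(q-1)+1,\,4(q-1)+2,\dots$: - normal: $a\to c,\ b\to d$ | $a\to d,\ b\to c$ | $c\to a,\ d\to b$ | $d\to a,\ c\to b$; - left: $a\to c,\ b\to d$ | $d\to a,\ c\to b$ | $c\to a,\ d\to b$ | $a\to d,\ b\to c$; - penultimate: $a\to c,\ b\to d$ | $a\to d,\ c\to b$ | $c\to a,\ d\to b$ | $d\to a,\ b\to c$; - last: $a\to b,\ c\to d$ | $a\to c,\ b\to d$ | $d\to a,\ b\to c$ | $c\to a,\ d\to b$ | $a\to d,\ c\to b$ | $b\to a,\ d\to c$ (bars separate consecutive days). **Theorem.** The resulting schedule is feasible for TTP-$2$, that is: 1. (fixed-game-value) each team plays exactly two games with each other team, one at its own home venue and one at the opponent's home venue (and no team plays itself); 2. (fixed-game-time) all games take place on the days $1,\dots,2(n-1)$, and each team plays exactly one game on each of these days; 3. (direct-traveling) each team has exactly one itinerary that starts at its home, visits the venue of its game of day $1$, of day $2$, …, of day $2(n-1)$, going directly from each to the next, and ends at its home; 4.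 (no-repeat) no two teams play against each other on two consecutive days; 5. (bounded-by-$2$) no team plays more than two consecutive home games or more than two consecutive away games. -/

import Mathlib

namespace TTP

/-! ### Sports schedules and feasibility -/

/-- A schedule on the set `T` of teams: `S d a h` says that on day `d` team `a` plays a game
against team `h` at the home venue of `h` (`a` is away, `h` is at home). Days count from `1`. -/
abbrev Schedule (T : Type*) := ℕ → T → T → Prop

variable {T : Type*}

/-- On day `d` teams `x` and `y` play against each other, at either venue. -/
def Schedule.Meet (S : Schedule T) (d : ℕ) (x y : T) : Prop := S d x y ∨ S d y x

/-- On day `d` team `t` plays a home game. -/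
def Schedule.HomeOn (S : Schedule T) (d : ℕ) (t : T) : Prop := ∃ a, S d a t

/-- On day `d` team `t` plays an away game. -/
def Schedule.AwayOn (S : Schedule T) (d : ℕ) (t : T) : Prop := ∃ h, S d t h

/-- `v` is the team whose home is the venue of a game of team `t` on day `d`. -/
def Schedule.Venue (S : Schedule T) (d : ℕ) (t v : T) : Prop :=
  ∃ a, S d a v ∧ (t = a ∨ t = v)

/-- Length of a double round-robin in days: `2 (n - 1)`, where `n` is the number of teams. -/
def numDays (T : Type*) [Fintype T] : ℕ := 2 * (Fintype.card T - 1)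

/-- No team plays itself, and any two different teams play exactly two games, exactly one at the
home venue of each of them. -/
def Schedule.FixedGameValue (S : Schedule T) : Prop :=
  (∀ d t, ¬ S d t t) ∧ ∀ a h, a ≠ h → ∃! d, S d a h

/-- All games take place on the days `1, …, 2 (n - 1)`, and on each of these days each team plays
exactly one game. -/
def Schedule.FixedGameTime [Fintype T] (S : Schedule T) : Prop :=
  (∀ d a h, S d a h → 1 ≤ d ∧ d ≤ numDays T) ∧
  ∀ d, 1 ≤ d → d ≤ numDays T → ∀ t : T, ∃! g : T × T, S d g.1 g.2 ∧ (t = g.1 ∨ t = g.2)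

/-- `r` is a direct-traveling itinerary of team `t`: it starts at the home of `t`, goes directly
from game venue to game venue, day by day, and ends at the home of `t`. -/
def Schedule.IsItinerary [Fintype T] (S : Schedule T) (t : T) (r : Fin (numDays T + 2) → T) :
    Prop :=
  r 0 = t ∧ r (Fin.last _) = t ∧
  ∀ d : Fin (numDays T + 2), 1 ≤ (d : ℕ) → (d : ℕ) ≤ numDays T → S.Venue d t (r d)

/-- The schedule determines for every team exactly one direct-traveling itinerary. -/
def Schedule.DirectTraveling [Fintype T] (S : Schedule T) : Prop :=
  ∀ t, ∃! r, S.IsItinerary t r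

/-- No two teams play against each other on two consecutive days. -/
def Schedule.NoRepeat (S : Schedule T) : Prop :=
  ∀ d x y, ¬ (S.Meet d x y ∧ S.Meet (d + 1) x y)

/-- No team has `k + 1` home games on consecutive days, nor `k + 1` away games. -/
def Schedule.BoundedBy (S : Schedule T) (k : ℕ) : Prop :=
  ∀ d t, (¬ ∀ i ≤ k, S.HomeOn (d + i) t) ∧ (¬ ∀ i ≤ k, S.AwayOn (d + i) t)

/-- Feasible schedules of the traveling tournament problem TTP-`k`. -/
structure Schedule.Feasible [Fintype T] (S : Schedule T) (k : ℕ) : Prop where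
  fixedGameValue : S.FixedGameValue
  fixedGameTime : S.FixedGameTime
  directTraveling : S.DirectTraveling
  noRepeat : S.NoRepeat
  boundedBy : S.BoundedBy k

/-! ### The super-game construction

There are `m` super-teams `u_1, …, u_m` (`m` even); `u_i` consists of the two teams
`t_{2i-1}` and `t_{2i}`. There are `m - 1` time slots `1, …, m - 1`. -/

/-- Position in time slot `q` of the super-team `u_i` (`1 ≤ i ≤ m - 1`) on the cycle of
positions `1, …, m - 1`: in slot `1` the super-team `u_i` is at position `i`, and from each slot to
the next one all of `u_1, …, u_{m-1}` move on by one position (from `m - 1` to `1`).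
The super-team `u_m` never moves. -/
def pos (m q i : ℕ) : ℕ := ((i - 1) + (q - 1)) % (m - 1) + 1

/-- In time slot `q` there is a super-game `u_i → u_j`, that is, `u_i` plays against `u_j` at the
home venue of `u_j`. The super-teams at the positions `p` and `m - 1 - p` play each other; in slot
`1` the edge leaves the even one of these two positions, and all these edges are reversed from
each slot to the next one. The super-team at position `m - 1` plays `u_m`; this edge enters `u_m`
in slot `1` and in slot `2`, and is reversed from each slot to the next one from slot `2` on. -/
def SuperGame (m q i j : ℕ) : Prop :=
  (1 ≤ q ∧ q ≤ m - 1) ∧ (1 ≤ i ∧ i ≤ m) ∧ (1 ≤ j ∧ j ≤ m) ∧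
  ((i < m ∧ j < m ∧ pos m q i + pos m q j = m - 1 ∧ (pos m q i + q) % 2 = 1) ∨
   (i < m ∧ j = m ∧ pos m q i = m - 1 ∧ (q = 1 ∨ q % 2 = 0)) ∨
   (i = m ∧ j < m ∧ pos m q j = m - 1 ∧ q ≠ 1 ∧ q % 2 = 1))

/-- The four kinds of super-games. -/
inductive Kind
  | normal
  | left
  | penultimate
  | last

/-- The kind of the super-game between `u_i` and `u_j` in time slot `q`. -/
def kind (m q i j : ℕ) : Kind :=
  if q = m - 1 then Kind.last
  else if q = m - 2 then Kind.penultimate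
  else if q ≠ 1 ∧ (i = m ∨ j = m) then Kind.left
  else Kind.normal

/-- The games on the `r`-th day of a super-game `{a, b} → {c, d}` of the given kind; `(x, y)` is
the game of `x` against `y` at the home venue of `y`. -/
def gamesOn (a b c d : ℕ) : Kind → ℕ → List (ℕ × ℕ)
  | Kind.normal, 1 => [(a, c), (b, d)]
  | Kind.normal, 2 => [(a, d), (b, c)]
  | Kind.normal, 3 => [(c, a), (d, b)]
  | Kind.normal, 4 => [(d, a), (c, b)]
  | Kind.left, 1 => [(a, c), (b, d)]
  | Kind.left, 2 => [(d, a), (c, b)]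
  | Kind.left, 3 => [(c, a), (d, b)]
  | Kind.left, 4 => [(a, d), (b, c)]
  | Kind.penultimate, 1 => [(a, c), (b, d)]
  | Kind.penultimate, 2 => [(a, d), (c, b)]
  | Kind.penultimate, 3 => [(c, a), (d, b)]
  | Kind.penultimate, 4 => [(d, a), (b, c)]
  | Kind.last, 1 => [(a, b), (c, d)]
  | Kind.last, 2 => [(a, c), (b, d)]
  | Kind.last, 3 => [(d, a), (b, c)]
  | Kind.last, 4 => [(c, a), (d, b)]
  | Kind.last, 5 => [(a, d), (c, b)]
  | Kind.last, 6 => [(b, a), (d, c)]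
  | _, _ => []

/-- The constructed schedule in terms of the numbers `1, …, 2m` of the teams: on the `r`-th day of
time slot `q`, which is day `4 (q - 1) + r`, each super-game of this slot contributes its games. -/
def numberedGame (m day x y : ℕ) : Prop :=
  ∃ q i j r, SuperGame m q i j ∧ day = 4 * (q - 1) + r ∧
    (x, y) ∈ gamesOn (2 * i - 1) (2 * i) (2 * j - 1) (2 * j) (kind m q i j) r

/-- The constructed schedule on a set `T` of `n` teams which are ordered by `order`; the team
with `order t = k - 1` is `t_k`, for `k = 1, …, n`. -/
def superGameSchedule (n : ℕ) (order : T ≃ Fin n) : Schedule T :=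
  fun day a h => numberedGame (n / 2) day ((order a : ℕ) + 1) ((order h : ℕ) + 1)

end TTP

namespace TTP

/-! ### Super-games -/

/-! The proof separates the tournament of super-teams from the games inside one super-game.

Since `m` is even, the cycle length `m - 1` is odd. Distinct `i, j < m` meet in slot `q` iff `i + j
+ 2q ≡ 2` modulo `m - 1`. This determines the opponent from the slot and, as `2` is invertible, the
slot from the pair. The solution with `i = j` is position `m - 1`, where `u_m` is the opponent. So
the super-games form a single round-robin (`exists_superGame`, `exists_slot`, `SuperGame.unique`,
`SuperGame.slot_unique`).

The games inside a super-game depend only on its kind and on four roles, so their properties are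
finite checks. Every kind contains both games of each cross pair; only the last one adds the games
between teammates.

Runs of home or away games across two slots depend on whether a super-team keeps its direction. It
does after a normal super-game and reverses after a left one (`SuperGame.follows`); the day patterns
fit this (`roleHome_bounded_of_follows`). After a penultimate super-game the direction is
irrelevant: the first team of each pair ends at home and starts the last slot away, the second
conversely. -/

theorem pos_cases {m q i : ℕ} (hq : 1 ≤ q) (hqm : q < m) (hi : 1 ≤ i) (him : i < m) :
    (i + q ≤ m ∧ pos m q i + 1 = i + q) ∨ (m < i + q ∧ pos m q i + m = i + q) := by
  unfold pos
  rcases le_or_gt (i + q) m with h | h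
  · left
    rw [Nat.mod_eq_of_lt (by omega)]
    omega
  · right
    rw [Nat.mod_eq_sub_mod (by omega), Nat.mod_eq_of_lt (by omega)]
    omega

/-- The super-games in terms of linear arithmetic. -/
theorem superGame_iff {m q i j : ℕ} :
    SuperGame m q i j ↔ 1 ≤ q ∧ q < m ∧ 1 ≤ i ∧ i ≤ m ∧ 1 ≤ j ∧ j ≤ m ∧
      ((i < m ∧ j < m ∧ i + q ≤ m ∧ j + q ≤ m ∧ i + j + 2 * q = m + 1 ∧ i % 2 = 0) ∨
       (i < m ∧ j < m ∧ i + q ≤ m ∧ m < j + q ∧ i + j + 2 * q = 2 * m ∧ i % 2 = 0) ∨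
       (i < m ∧ j < m ∧ m < i + q ∧ j + q ≤ m ∧ i + j + 2 * q = 2 * m ∧ (i + m) % 2 = 1) ∨
       (i < m ∧ j < m ∧ m < i + q ∧ m < j + q ∧ i + j + 2 * q + 1 = 3 * m ∧ (i + m) % 2 = 1) ∨
       (i < m ∧ j = m ∧ i + q = m ∧ (q = 1 ∨ q % 2 = 0)) ∨
       (i = m ∧ j < m ∧ j + q = m ∧ q ≠ 1 ∧ q % 2 = 1)) := by
  constructor
  · rintro ⟨⟨h1, h2⟩, ⟨h3, h4⟩, ⟨h5, h6⟩, h⟩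
    refine ⟨h1, by omega, h3, h4, h5, h6, ?_⟩
    rcases h with ⟨hi, hj, h, h'⟩ | ⟨hi, hj, h, h'⟩ | ⟨hi, hj, h, h'⟩
    -- Position plus slot is `i + 2q - 1` before the end of the cycle is passed and `i + 2q - m`
    -- afterwards, so its parity does not depend on `q`.
    · rcases pos_cases h1 (by omega) h3 hi with hp | hp <;>
        rcases pos_cases h1 (by omega) h5 hj with hp' | hp'
      · left; and_intros <;> omega
      · right; left; and_intros <;> omega
      · right; right; left; and_intros <;> omega
      · right; right; right; left; and_intros <;> omega
    · have := pos_cases h1 (by omega) h3 hi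
      right; right; right; right; left; refine ⟨hi, hj, by omega, h'⟩
    · have := pos_cases h1 (by omega) h5 hj
      right; right; right; right; right; refine ⟨hi, hj, by omega, h'⟩
  · rintro ⟨h1, h2, h3, h4, h5, h6, h⟩
    refine ⟨⟨h1, by omega⟩, ⟨h3, h4⟩, ⟨h5, h6⟩, ?_⟩
    rcases h with ⟨hi, hj, h⟩ | ⟨hi, hj, h⟩ | ⟨hi, hj, h⟩ | ⟨hi, hj, h⟩ | ⟨hi, hj, h, h'⟩ |
      ⟨hi, hj, h, h'⟩
    iterate 4
      have := pos_cases h1 h2 h3 hi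
      have := pos_cases h1 h2 h5 hj
      exact Or.inl ⟨hi, hj, by omega, by omega⟩
    · have := pos_cases h1 h2 h3 hi
      exact Or.inr (Or.inl ⟨hi, hj, by omega, h'⟩)
    · have := pos_cases h1 h2 h5 hj
      exact Or.inr (Or.inr ⟨hi, hj, by omega, h'⟩)

theorem SuperGame.ne {m q i j : ℕ} (hm : m % 2 = 0) (h : SuperGame m q i j) : i ≠ j := by
  obtain ⟨h1, h2, h3, h4, h5, h6, h⟩ := superGame_iff.1 h
  rintro rfl
  rcases h with h | h | h | h | h | h <;> omega

/-- A disjunction of linear conditions under which two super-teams play a super-game. -/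
theorem superGame_or {m q i j : ℕ} (hm : m % 2 = 0) (hq : 1 ≤ q) (hqm : q < m)
    (hi : 1 ≤ i) (hj : 1 ≤ j) (hij : i ≠ j) (hs : (i < m ∧ j < m ∧
      (i + j + 2 * q = m + 1 ∨ i + j + 2 * q = 2 * m ∨ i + j + 2 * q + 1 = 3 * m)) ∨
      (i < m ∧ j = m ∧ i + q = m) ∨ (i = m ∧ j < m ∧ j + q = m)) :
    SuperGame m q i j ∨ SuperGame m q j i := by
  have hp : i < m → _ := pos_cases hq hqm hi
  have hp' : j < m → _ := pos_cases hq hqm hj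
  unfold SuperGame
  rcases hs with ⟨h1, h2, h3⟩ | ⟨h1, h2, h3⟩ | ⟨h1, h2, h3⟩
  · have hsum : pos m q i + pos m q j = m - 1 := by
      specialize hp h1
      specialize hp' h2
      rcases h3 with h3 | h3 | h3 <;> omega
    -- The two positions have the odd sum `m - 1`, so exactly one of the two super-teams satisfies
    -- the parity condition for leaving.
    by_cases ho : (pos m q i + q) % 2 = 1
    · exact Or.inl ⟨by omega, by omega, by omega, Or.inl ⟨h1, h2, hsum, ho⟩⟩
    · exact Or.inr ⟨by omega, by omega, by omega, Or.inl ⟨h2, h1, by omega, by omega⟩⟩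
  · specialize hp h1
    by_cases ho : q = 1 ∨ q % 2 = 0
    · exact Or.inl ⟨by omega, by omega, by omega, Or.inr (Or.inl ⟨h1, h2, by omega, ho⟩)⟩
    · exact Or.inr ⟨by omega, by omega, by omega,
        Or.inr (Or.inr ⟨h2, h1, by omega, by omega, by omega⟩)⟩
  · specialize hp' h2
    by_cases ho : q = 1 ∨ q % 2 = 0
    · exact Or.inr ⟨by omega, by omega, by omega, Or.inr (Or.inl ⟨h2, h1, by omega, ho⟩)⟩
    · exact Or.inl ⟨by omega, by omega, by omega,
        Or.inr (Or.inr ⟨h1, h2, by omega, by omega, by omega⟩)⟩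

/-- Each super-team plays a super-game in each time slot. -/
theorem exists_superGame {m q i : ℕ} (hm : m % 2 = 0) (hq : 1 ≤ q) (hqm : q < m)
    (hi : 1 ≤ i) (him : i ≤ m) : ∃ j, SuperGame m q i j ∨ SuperGame m q j i := by
  rcases eq_or_lt_of_le him with rfl | him
  · exact ⟨i - q, superGame_or hm hq hqm hi (by omega) (by omega) (by omega)⟩
  · by_cases h : i + q = m
    · exact ⟨m, superGame_or hm hq hqm hi (by omega) (by omega) (by omega)⟩
    · by_cases h1 : i + 2 * q ≤ m
      · exact ⟨m + 1 - i - 2 * q, superGame_or hm hq hqm hi (by omega) (by omega) (by omega)⟩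
      · by_cases h2 : i + 2 * q < 2 * m
        · exact ⟨2 * m - i - 2 * q, superGame_or hm hq hqm hi (by omega) (by omega) (by omega)⟩
        · exact ⟨3 * m - 1 - i - 2 * q,
            superGame_or hm hq hqm hi (by omega) (by omega) (by omega)⟩

/-- Any two super-teams play a super-game. -/
theorem exists_slot {m i j : ℕ} (hm : m % 2 = 0) (hi : 1 ≤ i) (him : i ≤ m) (hj : 1 ≤ j)
    (hjm : j ≤ m) (hij : i ≠ j) : ∃ q, SuperGame m q i j ∨ SuperGame m q j i := by
  by_cases h : i = m ∨ j = m
  · exact ⟨2 * m - i - j, superGame_or hm (by omega) (by omega) hi hj hij (by omega)⟩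
  -- The possible values of `i + j + 2q` are `m + 1`, `2m` and `3m - 1`; only `2m` is even.
  · by_cases h1 : (i + j) % 2 = 0
    · exact ⟨m - (i + j) / 2, superGame_or hm (by omega) (by omega) hi hj hij (by omega)⟩
    · by_cases h2 : i + j < m
      · exact ⟨(m + 1 - i - j) / 2, superGame_or hm (by omega) (by omega) hi hj hij (by omega)⟩
      · exact ⟨(3 * m - 1 - i - j) / 2,
          superGame_or hm (by omega) (by omega) hi hj hij (by omega)⟩

/-- Two super-games of a time slot that share a super-team are equal. -/
theorem SuperGame.unique {m q i j i' j' : ℕ} (hm : m % 2 = 0) (h : SuperGame m q i j)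
    (h' : SuperGame m q i' j') (hs : i = i' ∨ i = j' ∨ j = i' ∨ j = j') : i = i' ∧ j = j' := by
  obtain ⟨h1, h2, h3, h4, h5, h6, h⟩ := superGame_iff.1 h
  obtain ⟨h1', h2', h3', h4', h5', h6', h'⟩ := superGame_iff.1 h'
  rcases hs with rfl | rfl | rfl | rfl <;> rcases h with h | h | h | h | h | h <;>
    rcases h' with h' | h' | h' | h' | h' | h' <;> omega

/-- Two super-teams play at most one super-game against each other. -/
theorem SuperGame.slot_unique {m q q' i j : ℕ} (hm : m % 2 = 0) (h : SuperGame m q i j)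
    (h' : SuperGame m q' i j ∨ SuperGame m q' j i) : q = q' := by
  obtain ⟨h1, h2, h3, h4, h5, h6, h⟩ := superGame_iff.1 h
  rw [superGame_iff, superGame_iff] at h'
  rcases h' with ⟨h1', h2', h3', h4', h5', h6', h'⟩ | ⟨h1', h2', h3', h4', h5', h6', h'⟩ <;>
    rcases h with h | h | h | h | h | h <;>
    rcases h' with h' | h' | h' | h' | h' | h' <;> omega

/-- `Kind.Follows k o k' o'`: a super-team with a super-game of kind `k` in one slot, which it
plays away first if `o` holds, can have one of kind `k'` in the next slot, which it plays away
first if `o'` holds. -/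
def Kind.Follows (k : Kind) (o : Prop) (k' : Kind) (o' : Prop) : Prop :=
  (k = penultimate ↔ k' = last) ∧ k ≠ last ∧ (k = normal → (o ↔ o')) ∧ (k = left → ¬ (o ↔ o'))

/-- Position and slot both grow by one, so the parity that fixes the direction persists, except on
the move from `m - 1` to `1`, both odd. That move comes right after the game against `u_m`, so it
reverses the direction; in slot `1` the exceptional edge into `u_m` cancels this. From slot `2` on,
`u_m` itself alternates. -/
theorem SuperGame.follows {m q i j i' j' w : ℕ} (hm : m % 2 = 0) (hm4 : 4 ≤ m)
    (h : SuperGame m q i j) (h' : SuperGame m (q + 1) i' j') (hw : w = i ∨ w = j)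
    (hw' : w = i' ∨ w = j') :
    Kind.Follows (kind m q i j) (w = i) (kind m (q + 1) i' j') (w = i') := by
  have hne := h.ne hm
  have hne' := h'.ne hm
  obtain ⟨h1, h2, h3, h4, h5, h6, h⟩ := superGame_iff.1 h
  obtain ⟨h1', h2', h3', h4', h5', h6', h'⟩ := superGame_iff.1 h'
  have hkeep : q = 1 ∨ (i ≠ m ∧ j ≠ m) → (w = i ↔ w = i') := by
    intro hq
    rcases hw with rfl | rfl <;> rcases hw' with rfl | rfl <;>
      rcases h with h | h | h | h | h | h <;>
      rcases h' with h' | h' | h' | h' | h' | h' <;> omega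
  have hflip : q ≠ 1 → (i = m ∨ j = m) → ¬ (w = i ↔ w = i') := by
    intro hq hij
    rcases hw with rfl | rfl <;> rcases hw' with rfl | rfl <;>
      rcases h with h | h | h | h | h | h <;>
      rcases h' with h' | h' | h' | h' | h' | h' <;> omega
  clear h h'
  unfold kind Kind.Follows
  refine ⟨?_, ?_, ?_, ?_⟩
  · split_ifs <;> simp <;> omega
  · split_ifs <;> simp
    omega
  · intro hk
    apply hkeep
    split_ifs at hk
    omega
  · intro hk
    split_ifs at hk
    exact hflip (by omega) (by omega)

/-! ### The games of a single super-game

The teams `a`, `b`, `c`, `d` of a super-game `{a, b} → {c, d}` have the roles `0`, `1`, `2`, `3`. -/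

section

set_option synthInstance.maxHeartbeats 400000
set_option synthInstance.maxSize 2000

/-- The number of days of a super-game. -/
def Kind.days : Kind → ℕ
  | last => 6
  | _ => 4

/-- On the `r`-th day of a super-game of kind `k` role `u` plays at the home venue of role `v`. -/
abbrev RoleGame (k : Kind) (r u v : ℕ) : Prop := (u, v) ∈ gamesOn 0 1 2 3 k r

/-- The number of the team with role `u` in the super-game `u_i → u_j`. -/
def member (i j u : ℕ) : ℕ := if u < 2 then 2 * i - 1 + u else 2 * j + u - 3

theorem mem_gamesOn_iff {i j r x y : ℕ} {k : Kind} (hi : 1 ≤ i) :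
    (x, y) ∈ gamesOn (2 * i - 1) (2 * i) (2 * j - 1) (2 * j) k r ↔
      ∃ u v, RoleGame k r u v ∧ x = member i j u ∧ y = member i j v := by
  have h0 : 2 * i - 1 = member i j 0 := rfl
  have h1 : 2 * i = member i j 1 := by simp [member]; omega
  have h2 : 2 * j - 1 = member i j 2 := rfl
  have h3 : 2 * j = member i j 3 := rfl
  -- The lists are natural in the names of the teams, so everything reduces to the concrete roles
  -- `0, 1, 2, 3`.
  have hmap : ∀ f : ℕ → ℕ, gamesOn (f 0) (f 1) (f 2) (f 3) k r =
      (gamesOn 0 1 2 3 k r).map (Prod.map f f) := by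
    intro f
    unfold gamesOn
    split <;> rfl
  rw [h0, h1, h2, h3, hmap, List.mem_map]
  simp only [Prod.exists, Prod.map_apply, Prod.mk.injEq, eq_comm]

theorem RoleGame.bounds {k : Kind} {r u v : ℕ} (h : RoleGame k r u v) :
    1 ≤ r ∧ r ≤ k.days ∧ u < 4 ∧ v < 4 ∧ u ≠ v := by
  unfold RoleGame gamesOn at h
  split at h <;> simp at h <;> rcases h with ⟨rfl, rfl⟩ | ⟨rfl, rfl⟩ <;> simp [Kind.days]

/-- The partner of role `u` on the `r`-th day. -/
def partner (k : Kind) (r u : ℕ) : ℕ :=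
  ((gamesOn 0 1 2 3 k r).map fun g => if g.1 = u then g.2 else if g.2 = u then g.1 else 0).sum

/-- Role `u` has a home game on the `r`-th day. -/
abbrev RoleHome (k : Kind) (r u : ℕ) : Prop := RoleGame k r (partner k r u) u

instance (k : Kind) (r u v : ℕ) : Decidable (RoleGame k r u v) :=
  inferInstanceAs (Decidable (_ ∈ _))

/-- Each role occurs in exactly one game per day, so at most one summand in `partner` is nonzero; a
partner with role `0` rightly contributes `0`. -/
theorem partner_spec : ∀ (k : Kind), ∀ r ≤ k.days, 1 ≤ r → ∀ u < 4, partner k r u < 4 ∧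
    (¬ RoleHome k r u ↔ RoleGame k r u (partner k r u)) ∧
    ∀ v < 4, (RoleGame k r u v ∨ RoleGame k r v u → v = partner k r u) := by
  intro k
  cases k <;> decide

theorem partner_succ_ne : ∀ (k : Kind), ∀ r < k.days, 1 ≤ r → ∀ u < 4,
    partner k r u ≠ partner k (r + 1) u := by
  intro k
  cases k <;> decide

theorem existsUnique_roleGame : ∀ (k : Kind), ∀ u < 4, ∀ v < 4, u ≠ v →
    (k = Kind.last ∨ u / 2 ≠ v / 2) → ∃! r, RoleGame k r u v := by
  -- No kind has games after day `6`, so bounding the day by `7` makes the statement decidable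
  -- without loss.
  have h : ∀ (k : Kind), ∀ u < 4, ∀ v < 4, u ≠ v → (k = Kind.last ∨ u / 2 ≠ v / 2) →
      ∃ r < 7, RoleGame k r u v ∧ ∀ r' < 7, RoleGame k r' u v → r' = r := by
    intro k
    cases k <;> simp only [reduceCtorEq, true_or, false_or, forall_const] <;> decide
  intro k u hu v hv huv hk
  obtain ⟨r, -, h1, h2⟩ := h k u hu v hv huv hk
  refine ⟨r, h1, fun r' hr' => h2 r' ?_ hr'⟩
  have := hr'.bounds.2.1
  have : k.days ≤ 6 := by cases k <;> decide
  omega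

theorem RoleGame.div_ne : ∀ {k : Kind} {r u v : ℕ}, RoleGame k r u v → k ≠ Kind.last →
    u / 2 ≠ v / 2 := by
  have h : ∀ (k : Kind), k ≠ Kind.last → ∀ r < 5, ∀ u < 4, ∀ v < 4, RoleGame k r u v →
      u / 2 ≠ v / 2 := by
    intro k
    cases k <;> simp only [ne_eq, reduceCtorEq, not_true_eq_false, not_false_eq_true,
      forall_const, IsEmpty.forall_iff] <;> decide
  intro k r u v huv hk
  obtain ⟨h1, h2, h3, h4, -⟩ := huv.bounds
  refine h k hk r ?_ u h3 v h4 huv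
  cases k <;> simp [Kind.days] at h2 hk ⊢ <;> omega

/-- No role has three home games or three away games in a row. -/
theorem roleHome_bounded : ∀ (k : Kind), ∀ r < k.days - 1, 1 ≤ r → ∀ u < 4,
    ¬ ((RoleHome k r u ↔ RoleHome k (r + 1) u) ∧
      (RoleHome k (r + 1) u ↔ RoleHome k (r + 2) u)) := by
  intro k
  cases k <;> decide

/-- No team has three home games or three away games in a row around the end of a super-game. -/
theorem roleHome_bounded_of_follows : ∀ (k k' : Kind), ∀ u < 4, ∀ u' < 4, u % 2 = u' % 2 →
    Kind.Follows k (u < 2) k' (u' < 2) →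
    ¬ ((RoleHome k 3 u ↔ RoleHome k 4 u) ∧ (RoleHome k 4 u ↔ RoleHome k' 1 u')) ∧
    ¬ ((RoleHome k 4 u ↔ RoleHome k' 1 u') ∧ (RoleHome k' 1 u' ↔ RoleHome k' 2 u')) := by
  intro k k'
  -- `Kind.Follows` excludes `k = last`, so day `4` ends the first super-game; the conjuncts are the
  -- two ways for three days to straddle the boundary.
  cases k <;> cases k' <;> simp only [Kind.Follows, reduceCtorEq, ne_eq, not_true_eq_false,
    not_false_eq_true, iff_self, true_and, and_true, true_imp_iff, false_imp_iff, iff_false,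
    iff_true, false_and, imp_true_iff, and_false, and_self] <;> decide

end

/-! ### The place of a team in the schedule -/

theorem kind_eq_last_iff {m q i j : ℕ} : kind m q i j = Kind.last ↔ q = m - 1 := by
  unfold kind
  split_ifs <;> simp_all

theorem days_kind (m q i j : ℕ) : (kind m q i j).days = if q = m - 1 then 6 else 4 := by
  unfold kind
  split_ifs <;> rfl

theorem member_div {i j u : ℕ} (hi : 1 ≤ i) (hj : 1 ≤ j) (hu : u < 4) :
    (member i j u + 1) / 2 = if u < 2 then i else j := by
  unfold member
  split_ifs <;> omega

theorem member_mod {i j u : ℕ} (hi : 1 ≤ i) (hj : 1 ≤ j) : (member i j u + 1) % 2 = u % 2 := by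
  unfold member
  split_ifs <;> omega

theorem member_injective {i j u v : ℕ} (hi : 1 ≤ i) (hj : 1 ≤ j) (hij : i ≠ j) (hu : u < 4)
    (hv : v < 4) (h : member i j u = member i j v) : u = v := by
  have h1 := member_div hi hj hu
  have h2 := member_div hi hj hv
  have h3 := member_mod (u := u) hi hj
  have h4 := member_mod (u := v) hi hj
  rw [h] at h1 h3
  split_ifs at h1 h2 <;> omega

/-- Day `d` is the `r`-th day of time slot `q`, in which the team number `x` takes part in the
super-game `u_i → u_j` with role `u`. -/
structure Seat (m d x q i j r u : ℕ) : Prop where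
  game : SuperGame m q i j
  day : d = 4 * (q - 1) + r
  one_le : 1 ≤ r
  le_days : r ≤ (kind m q i j).days
  role : u < 4
  team : x = member i j u

section

variable {m d x q i j r u d' y q' i' j' r' u' v v' : ℕ}

theorem SuperGame.bounds (h : SuperGame m q i j) :
    1 ≤ q ∧ q < m ∧ 1 ≤ i ∧ i ≤ m ∧ 1 ≤ j ∧ j ≤ m := by
  unfold SuperGame at h
  omega

theorem Seat.slot_cases (s : Seat m d x q i j r u) :
    1 ≤ q ∧ 1 ≤ r ∧ (q + 1 < m ∧ r ≤ 4 ∨ q + 1 = m ∧ r ≤ 6) ∧ d = 4 * (q - 1) + r := by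
  have h1 := s.le_days
  have h2 := s.game.bounds
  have h3 := s.one_le
  have h4 := s.day
  rw [days_kind] at h1
  split_ifs at h1 <;> omega

theorem Seat.super (s : Seat m d x q i j r u) :
    u < 2 ∧ (x + 1) / 2 = i ∨ 2 ≤ u ∧ (x + 1) / 2 = j := by
  have hb := s.game.bounds
  have h := member_div (i := i) (j := j) (by omega) (by omega) s.role
  rw [← s.team] at h
  split_ifs at h <;> omega

theorem Seat.mod (s : Seat m d x q i j r u) : (x + 1) % 2 = u % 2 := by
  have hb := s.game.bounds
  rw [s.team, member_mod (by omega) (by omega)]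

theorem Seat.team_bounds (s : Seat m d x q i j r u) : 1 ≤ x ∧ x ≤ 2 * m := by
  have hb := s.game.bounds
  have h := s.super
  have := s.mod
  omega

/-- The days may differ: a team keeps its super-game and its role throughout a slot. -/
theorem Seat.unique_of_slot (hm : m % 2 = 0) (s : Seat m d x q i j r u)
    (s' : Seat m d' x q i' j' r' u') : i = i' ∧ j = j' ∧ u = u' := by
  obtain ⟨rfl, rfl⟩ := s.game.unique hm s'.game (by
    have := s.super
    have := s'.super
    omega)
  have hb := s.game.bounds
  exact ⟨rfl, rfl, member_injective (by omega) (by omega) (s.game.ne hm) s.role s'.role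
    (s.team.symm.trans s'.team)⟩

theorem Seat.unique (hm : m % 2 = 0) (s : Seat m d x q i j r u)
    (s' : Seat m d x q' i' j' r' u') : q = q' ∧ i = i' ∧ j = j' ∧ r = r' ∧ u = u' := by
  have h := s.slot_cases
  have h' := s'.slot_cases
  obtain rfl : q = q' := by omega
  obtain ⟨rfl, rfl, rfl⟩ := s.unique_of_slot hm s'
  exact ⟨rfl, rfl, rfl, by omega, rfl⟩

theorem exists_seat (hm : m % 2 = 0) (hm2 : 2 ≤ m) (hd : 1 ≤ d) (hdm : d ≤ 4 * m - 2) (hx : 1 ≤ x)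
    (hxm : x ≤ 2 * m) : ∃ q i j r u, Seat m d x q i j r u := by
  obtain ⟨q, r, hq, hqm, hday, hr, hrq⟩ : ∃ q r, 1 ≤ q ∧ q < m ∧ d = 4 * (q - 1) + r ∧ 1 ≤ r ∧
      r ≤ if q = m - 1 then 6 else 4 := by
    -- The first `m - 2` slots take four days each; the remaining six days form slot `m - 1`.
    by_cases h : d ≤ 4 * (m - 2)
    · refine ⟨(d + 3) / 4, d - 4 * ((d + 3) / 4 - 1), by omega, by omega, by omega, by omega, ?_⟩
      split_ifs <;> omega
    · refine ⟨m - 1, d - 4 * (m - 2), by omega, by omega, by omega, by omega, ?_⟩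
      split_ifs <;> omega
  obtain ⟨j, hj⟩ := exists_superGame (i := (x + 1) / 2) hm hq hqm (by omega) (by omega)
  rcases hj with hj | hj
  · refine ⟨q, _, j, r, (x + 1) % 2, hj, hday, hr, by rwa [days_kind], by omega, ?_⟩
    unfold member
    split_ifs <;> omega
  · refine ⟨q, j, _, r, 2 + (x + 1) % 2, hj, hday, hr, by rwa [days_kind], by omega, ?_⟩
    unfold member
    split_ifs <;> omega

/-! ### The games of the schedule -/

theorem numberedGame_iff : numberedGame m d x y ↔ ∃ q i j r u v, Seat m d x q i j r u ∧
    Seat m d y q i j r v ∧ RoleGame (kind m q i j) r u v := by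
  unfold numberedGame
  constructor
  · rintro ⟨q, i, j, r, hg, hd, h⟩
    have hb := hg.bounds
    obtain ⟨u, v, h, hx, hy⟩ := (mem_gamesOn_iff (by omega)).1 h
    obtain ⟨h1, h2, hu, hv, -⟩ := h.bounds
    exact ⟨q, i, j, r, u, v, ⟨hg, hd, h1, h2, hu, hx⟩, ⟨hg, hd, h1, h2, hv, hy⟩, h⟩
  · rintro ⟨q, i, j, r, u, v, s, s', h⟩
    have hb := s.game.bounds
    exact ⟨q, i, j, r, s.game, s.day,
      (mem_gamesOn_iff (by omega)).2 ⟨u, v, h, s.team, s'.team⟩⟩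

theorem Seat.away_iff (hm : m % 2 = 0) (s : Seat m d x q i j r u) :
    numberedGame m d x y ↔ y = member i j (partner (kind m q i j) r u) ∧
      ¬ RoleHome (kind m q i j) r u := by
  obtain ⟨h1, h2, h3⟩ := partner_spec _ r s.le_days s.one_le u s.role
  rw [numberedGame_iff, h2]
  constructor
  · rintro ⟨q', i', j', r', u', v, s', t, h⟩
    obtain ⟨rfl, rfl, rfl, rfl, rfl⟩ := s.unique hm s'
    obtain rfl := h3 v t.role (Or.inl h)
    exact ⟨t.team, h⟩
  · rintro ⟨h, h'⟩
    exact ⟨q, i, j, r, u, _, s, ⟨s.game, s.day, s.one_le, s.le_days, h1, h⟩, h'⟩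

theorem Seat.home_iff (hm : m % 2 = 0) (s : Seat m d x q i j r u) :
    numberedGame m d y x ↔ y = member i j (partner (kind m q i j) r u) ∧
      RoleHome (kind m q i j) r u := by
  obtain ⟨h1, -, h3⟩ := partner_spec _ r s.le_days s.one_le u s.role
  rw [numberedGame_iff]
  constructor
  · rintro ⟨q', i', j', r', v, u', t, s', h⟩
    obtain ⟨rfl, rfl, rfl, rfl, rfl⟩ := s.unique hm s'
    obtain rfl := h3 v t.role (Or.inr h)
    exact ⟨t.team, h⟩
  · rintro ⟨h, h'⟩
    exact ⟨q, i, j, r, _, u, ⟨s.game, s.day, s.one_le, s.le_days, h1, h⟩, s, h'⟩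

theorem Seat.follows (hm : m % 2 = 0) (hm4 : 4 ≤ m) (s : Seat m d x q i j r u)
    (s' : Seat m d' x (q + 1) i' j' r' u') : u % 2 = u' % 2 ∧
      Kind.Follows (kind m q i j) (u < 2) (kind m (q + 1) i' j') (u' < 2) := by
  have h := s.super
  have h' := s'.super
  have hne := s.game.ne hm
  have hne' := s'.game.ne hm
  have hf := s.game.follows (w := (x + 1) / 2) hm hm4 s'.game (by omega) (by omega)
  have e : (x + 1) / 2 = i ↔ u < 2 := by omega
  have e' : (x + 1) / 2 = i' ↔ u' < 2 := by omega
  rw [e, e'] at hf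
  exact ⟨s.mod.symm.trans s'.mod, hf⟩

/-- Two teams of different super-teams take part in the same super-game in one slot only. -/
theorem Seat.slot_eq (hm : m % 2 = 0) (hxy : (x + 1) / 2 ≠ (y + 1) / 2)
    (s : Seat m d x q i j r u) (t : Seat m d y q i j r v)
    (s' : Seat m d' x q' i' j' r' u') (t' : Seat m d' y q' i' j' r' v') : q = q' := by
  have h1 := s.super
  have h2 := t.super
  have h3 := s'.super
  have h4 := t'.super
  refine s.game.slot_unique hm ?_
  have hs' := s'.game
  obtain ⟨rfl, rfl⟩ | ⟨rfl, rfl⟩ : i = i' ∧ j = j' ∨ i = j' ∧ j = i' := by omega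
  · exact Or.inl hs'
  · exact Or.inr hs'

/-! ### Consecutive days, and the unique day of each game -/

theorem not_meet_succ (hm : m % 2 = 0) (h : numberedGame m d x y ∨ numberedGame m d y x)
    (h' : numberedGame m (d + 1) x y ∨ numberedGame m (d + 1) y x) : False := by
  have key : ∀ {d}, numberedGame m d x y ∨ numberedGame m d y x → ∃ q i j r u v,
      Seat m d x q i j r u ∧ Seat m d y q i j r v ∧
      (RoleGame (kind m q i j) r u v ∨ RoleGame (kind m q i j) r v u) := by
    rintro d (h | h)
    · obtain ⟨q, i, j, r, u, v, s, t, h⟩ := numberedGame_iff.1 h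
      exact ⟨q, i, j, r, u, v, s, t, Or.inl h⟩
    · obtain ⟨q, i, j, r, u, v, s, t, h⟩ := numberedGame_iff.1 h
      exact ⟨q, i, j, r, v, u, t, s, Or.inr h⟩
  obtain ⟨q, i, j, r, u, v, s, t, hg⟩ := key h
  obtain ⟨q', i', j', r', u', v', s', t', hg'⟩ := key h'
  have hs := s.slot_cases
  have hs' := s'.slot_cases
  by_cases hqq : q = q'
  · subst hqq
    obtain ⟨rfl, rfl, rfl⟩ := s.unique_of_slot hm s'
    obtain ⟨-, -, rfl⟩ := t.unique_of_slot hm t'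
    obtain rfl : r' = r + 1 := by omega
    have e := (partner_spec _ r s.le_days s.one_le u s.role).2.2 v t.role hg
    have e' := (partner_spec _ _ s'.le_days s'.one_le u s.role).2.2 v t.role hg'
    exact partner_succ_ne _ r (Nat.lt_of_succ_le s'.le_days) s.one_le u s.role (e.symm.trans e')
  -- A later slot follows, so the teams are not teammates; their super-teams would then meet in two
  -- slots.
  · have hk : kind m q i j ≠ Kind.last := by
      rw [Ne, kind_eq_last_iff]
      omega
    have hne : u / 2 ≠ v / 2 := by
      rcases hg with hg | hg
      · exact hg.div_ne hk
      · exact (hg.div_ne hk).symm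
    have hij := s.game.ne hm
    have h1 := s.super
    have h2 := t.super
    have := s.role
    have := t.role
    exact hqq (s.slot_eq hm (by omega) t s' t')

theorem Seat.bounded (hm : m % 2 = 0) (hm4 : 4 ≤ m) {q₁ i₁ j₁ r₁ u₁ q₂ i₂ j₂ r₂ u₂ : ℕ}
    (s : Seat m d x q i j r u) (s₁ : Seat m (d + 1) x q₁ i₁ j₁ r₁ u₁)
    (s₂ : Seat m (d + 2) x q₂ i₂ j₂ r₂ u₂) :
    ¬ ((RoleHome (kind m q i j) r u ↔ RoleHome (kind m q₁ i₁ j₁) r₁ u₁) ∧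
      (RoleHome (kind m q₁ i₁ j₁) r₁ u₁ ↔ RoleHome (kind m q₂ i₂ j₂) r₂ u₂)) := by
  have h := s.slot_cases
  have h₁ := s₁.slot_cases
  have h₂ := s₂.slot_cases
  -- Every slot has at least four days, so three consecutive days touch at most two slots.
  by_cases hq₂ : q = q₂
  · obtain rfl : q = q₁ := by omega
    subst hq₂
    obtain ⟨rfl, rfl, rfl⟩ := s.unique_of_slot hm s₁
    obtain ⟨rfl, rfl, rfl⟩ := s.unique_of_slot hm s₂
    obtain rfl : r₁ = r + 1 := by omega
    obtain rfl : r₂ = r + 2 := by omega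
    have := s₂.le_days
    exact roleHome_bounded _ r (by omega) s.one_le u s.role
  · obtain rfl : q₂ = q + 1 := by omega
    obtain ⟨hu, hf⟩ := s.follows hm hm4 s₂
    have hb := roleHome_bounded_of_follows _ _ u s.role u₂ s₂.role hu hf
    by_cases hq₁ : q = q₁
    · subst hq₁
      obtain ⟨rfl, rfl, rfl⟩ := s.unique_of_slot hm s₁
      obtain rfl : r = 3 := by omega
      obtain rfl : r₁ = 4 := by omega
      obtain rfl : r₂ = 1 := by omega
      exact hb.1
    · obtain rfl : q₁ = q + 1 := by omega
      obtain ⟨rfl, rfl, rfl⟩ := s₁.unique_of_slot hm s₂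
      obtain rfl : r = 4 := by omega
      obtain rfl : r₁ = 1 := by omega
      obtain rfl : r₂ = 2 := by omega
      exact hb.2

theorem existsUnique_day (hm : m % 2 = 0) (hm2 : 2 ≤ m) (hx : 1 ≤ x) (hxm : x ≤ 2 * m)
    (hy : 1 ≤ y) (hym : y ≤ 2 * m) (hxy : x ≠ y) : ∃! d, numberedGame m d x y := by
  obtain ⟨q, i, j, u, v, hg, hu, hv, rfl, rfl, hk⟩ : ∃ q i j u v, SuperGame m q i j ∧ u < 4 ∧
      v < 4 ∧ x = member i j u ∧ y = member i j v ∧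
      (kind m q i j = Kind.last ∨ u / 2 ≠ v / 2) := by
    simp only [kind_eq_last_iff]
    -- Teammates meet in whatever super-game their super-team plays in the last slot, other teams in
    -- the unique slot of their super-teams.
    by_cases hab : (x + 1) / 2 = (y + 1) / 2
    · obtain ⟨j, h | h⟩ := exists_superGame (q := m - 1) (i := (x + 1) / 2) hm (by omega)
        (by omega) (by omega) (by omega)
      · refine ⟨m - 1, _, j, (x + 1) % 2, (y + 1) % 2, h, by omega, by omega, ?_, ?_, by simp⟩ <;>
          unfold member <;> split_ifs <;> omega
      · refine ⟨m - 1, j, _, 2 + (x + 1) % 2, 2 + (y + 1) % 2, h, by omega, by omega, ?_, ?_,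
          by simp⟩ <;> unfold member <;> split_ifs <;> omega
    · obtain ⟨q, h | h⟩ := exists_slot (i := (x + 1) / 2) (j := (y + 1) / 2) hm (by omega)
        (by omega) (by omega) (by omega) hab
      · refine ⟨q, _, _, (x + 1) % 2, 2 + (y + 1) % 2, h, by omega, by omega, ?_, ?_, by omega⟩ <;>
          unfold member <;> split_ifs <;> omega
      · refine ⟨q, _, _, 2 + (x + 1) % 2, (y + 1) % 2, h, by omega, by omega, ?_, ?_, by omega⟩ <;>
          unfold member <;> split_ifs <;> omega
  have huv : u ≠ v := by
    rintro rfl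
    exact hxy rfl
  obtain ⟨r, hr, hr'⟩ := existsUnique_roleGame _ u hu v hv huv hk
  obtain ⟨h1, h2, -⟩ := hr.bounds
  have s : Seat m (4 * (q - 1) + r) _ q i j r u := ⟨hg, rfl, h1, h2, hu, rfl⟩
  have t : Seat m (4 * (q - 1) + r) _ q i j r v := ⟨hg, rfl, h1, h2, hv, rfl⟩
  refine ⟨_, numberedGame_iff.2 ⟨q, i, j, r, u, v, s, t, hr⟩, fun d' h' => ?_⟩
  obtain ⟨q', i', j', r', u', v', s', t', h'⟩ := numberedGame_iff.1 h'
  have hq : q = q' := by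
    have e1 := s.super
    have e2 := t.super
    have e3 := s'.super
    have e4 := t'.super
    have hij := hg.ne hm
    have hij' := s'.game.ne hm
    by_cases hab : (member i j u + 1) / 2 = (member i j v + 1) / 2
    · have hu' := s'.role
      have hv' := t'.role
      have hl' : kind m q' i' j' = Kind.last := by
        by_contra hl'
        have := h'.div_ne hl'
        omega
      have hl := hk.resolve_right (by omega)
      rw [kind_eq_last_iff] at hl hl'
      omega
    · exact s.slot_eq hm hab t s' t'
  subst hq
  obtain ⟨rfl, rfl, rfl⟩ := s.unique_of_slot hm s'
  obtain ⟨-, -, rfl⟩ := t.unique_of_slot hm t'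
  obtain rfl := hr' r' h'
  exact s'.day

end

/-! ### Feasibility -/

/-- One game per day determines one venue per day, and the two remaining entries of the itinerary
are the home of the team. -/
theorem Schedule.FixedGameTime.directTraveling {T : Type*} [Fintype T] {S : Schedule T}
    (hS : S.FixedGameTime) : S.DirectTraveling := by
  intro t
  have hv : ∀ d, 1 ≤ d → d ≤ numDays T → ∃! v, S.Venue d t v := by
    intro d h1 h2
    obtain ⟨g, ⟨hg, ht⟩, hu⟩ := hS.2 d h1 h2 t
    refine ⟨g.2, ⟨g.1, hg, ht⟩, ?_⟩
    rintro v ⟨a, ha, hta⟩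
    exact congrArg Prod.snd (hu (a, v) ⟨ha, hta⟩)
  have : Nonempty T := ⟨t⟩
  choose! f hf hf' using hv
  refine ⟨fun d => if 1 ≤ (d : ℕ) ∧ (d : ℕ) ≤ numDays T then f d else t, ⟨?_, ?_, ?_⟩, ?_⟩
  · simp
  · simp
  · intro d h1 h2
    simp only [h1, h2, and_self, if_true]
    exact hf d h1 h2
  · rintro r ⟨h0, hl, hr⟩
    funext d
    split_ifs with hd
    · exact hf' d hd.1 hd.2 _ (hr d hd.1 hd.2)
    · have := d.isLt
      obtain h | h : d = 0 ∨ d = Fin.last _ := by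
        simp only [Fin.ext_iff, Fin.val_zero, Fin.val_last]
        omega
      · rw [h, h0]
      · rw [h, hl]

end TTP

theorem theorem3 (n : ℕ) (hmod : n ≡ 0 [MOD 4]) (hn : 8 ≤ n)
    {T : Type*} [Fintype T] (order : T ≃ Fin n) :
    (TTP.superGameSchedule n order).Feasible 2 := by
  open TTP in
  obtain ⟨m, hm, hm4, rfl⟩ : ∃ m, m % 2 = 0 ∧ 4 ≤ m ∧ n = 2 * m := by
    have : n % 4 = 0 := hmod
    exact ⟨n / 2, by omega, by omega, by omega⟩
  have hS : ∀ d a h, superGameSchedule (2 * m) order d a h ↔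
      numberedGame m d ((order a : ℕ) + 1) ((order h : ℕ) + 1) := by
    intro d a h
    unfold superGameSchedule
    rw [Nat.mul_div_cancel_left m (by omega)]
  have hdays : numDays T = 4 * m - 2 := by
    rw [numDays, Fintype.card_congr order, Fintype.card_fin]
    omega
  have hb : ∀ t, 1 ≤ (order t : ℕ) + 1 ∧ (order t : ℕ) + 1 ≤ 2 * m := by
    intro t
    have := (order t).isLt
    omega
  have hinj : ∀ a h, (order a : ℕ) + 1 = (order h : ℕ) + 1 → a = h := by
    intro a h e
    exact order.injective (Fin.ext (by omega))
  have htime : (superGameSchedule (2 * m) order).FixedGameTime := by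
    refine ⟨fun d a h hg => ?_, fun d h1 h2 t => ?_⟩
    · obtain ⟨q, i, j, r, u, v, s, -⟩ := numberedGame_iff.1 ((hS d a h).1 hg)
      have := s.slot_cases
      omega
    · obtain ⟨q, i, j, r, u, s⟩ := exists_seat hm (by omega) h1 (hdays ▸ h2) (hb t).1 (hb t).2
      have hp := (partner_spec _ r s.le_days s.one_le u s.role).1
      have t' : Seat m d _ q i j r (partner (kind m q i j) r u) :=
        ⟨s.game, s.day, s.one_le, s.le_days, hp, rfl⟩
      have hy := t'.team_bounds
      -- The opponent's number lies between `1` and `2m`, so it belongs to an actual team.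
      obtain ⟨y, hy⟩ : ∃ y, (order y : ℕ) + 1 = member i j (partner (kind m q i j) r u) :=
        ⟨order.symm ⟨member i j (partner (kind m q i j) r u) - 1, by omega⟩, by
          rw [Equiv.apply_symm_apply]
          simp only
          omega⟩
      by_cases hh : RoleHome (kind m q i j) r u
      · refine ⟨(y, t), ⟨(hS _ _ _).2 ((s.home_iff hm).2 ⟨hy, hh⟩), Or.inr rfl⟩, ?_⟩
        rintro ⟨a, h⟩ ⟨hg, rfl | rfl⟩
        · exact absurd hh ((s.away_iff hm).1 ((hS _ _ _).1 hg)).2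
        · rw [hinj a y (((s.home_iff hm).1 ((hS _ _ _).1 hg)).1.trans hy.symm)]
      · refine ⟨(t, y), ⟨(hS _ _ _).2 ((s.away_iff hm).2 ⟨hy, hh⟩), Or.inl rfl⟩, ?_⟩
        rintro ⟨a, h⟩ ⟨hg, rfl | rfl⟩
        · rw [hinj h y (((s.away_iff hm).1 ((hS _ _ _).1 hg)).1.trans hy.symm)]
        · exact absurd ((s.home_iff hm).1 ((hS _ _ _).1 hg)).2 hh
  refine ⟨⟨fun d t hg => ?_, fun a h hah => ?_⟩, htime, htime.directTraveling, ?_, ?_⟩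
  · obtain ⟨q, i, j, r, u, v, s, t, h⟩ := numberedGame_iff.1 ((hS d t t).1 hg)
    exact h.bounds.2.2.2.2 (s.unique_of_slot hm t).2.2
  · simp only [hS]
    exact existsUnique_day hm (by omega) (hb a).1 (hb a).2 (hb h).1 (hb h).2
      fun e => hah (hinj a h e)
  · rintro d x y ⟨h, h'⟩
    simp only [Schedule.Meet, hS] at h h'
    exact not_meet_succ hm h h'
  · intro d t
    refine ⟨fun h => ?_, fun h => ?_⟩
    -- Having a game already yields a seat, so days outside the season need no separate treatment.
    · have key : ∀ e ≤ 2, ∃ q i j r u, Seat m (d + e) ((order t : ℕ) + 1) q i j r u ∧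
          RoleHome (kind m q i j) r u := by
        intro e he
        obtain ⟨a, ha⟩ := h e he
        obtain ⟨q, i, j, r, v, u, -, s, -⟩ := numberedGame_iff.1 ((hS _ _ _).1 ha)
        exact ⟨q, i, j, r, u, s, ((s.home_iff hm).1 ((hS _ _ _).1 ha)).2⟩
      obtain ⟨q, i, j, r, u, s, h0⟩ := key 0 (by omega)
      obtain ⟨q₁, i₁, j₁, r₁, u₁, s₁, h1⟩ := key 1 (by omega)
      obtain ⟨q₂, i₂, j₂, r₂, u₂, s₂, h2⟩ := key 2 (by omega)
      exact s.bounded hm hm4 s₁ s₂ ⟨iff_of_true h0 h1, iff_of_true h1 h2⟩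
    · have key : ∀ e ≤ 2, ∃ q i j r u, Seat m (d + e) ((order t : ℕ) + 1) q i j r u ∧
          ¬ RoleHome (kind m q i j) r u := by
        intro e he
        obtain ⟨a, ha⟩ := h e he
        obtain ⟨q, i, j, r, u, v, s, -, -⟩ := numberedGame_iff.1 ((hS _ _ _).1 ha)
        exact ⟨q, i, j, r, u, s, ((s.away_iff hm).1 ((hS _ _ _).1 ha)).2⟩
      obtain ⟨q, i, j, r, u, s, h0⟩ := key 0 (by omega)
      obtain ⟨q₁, i₁, j₁, r₁, u₁, s₁, h1⟩ := key 1 (by omega)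
      obtain ⟨q₂, i₂, j₂, r₂, u₂, s₂, h2⟩ := key 2 (by omega)
      exact s.bounded hm hm4 s₁ s₂ ⟨iff_of_false h0 h1, iff_of_false h1 h2⟩
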